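/- Let $n,k\in\{0,1,2,\dots\}\cup\{\infty\}$ with $k\ge 1$. Let $\Lambda$ be a smooth manifold (finite-dimensional, Hausdorff, second countable, without boundary) with a $C^n$ Lorentzian metric $g$ of signature $(+,-,\dots,-)$. A \emph{non-spacelike curve} is a $C^k$ curve $\gamma$ defined on a nonempty open interval of $\mathbb R$ with $\dot\gamma\neq 0$ and $g[\dot\gamma,\dot\gamma]\ge 0$ everywhere; it is \emph{inextendible} if it has no endpoint, that is, $\gamma(\lambda)$ converges neither as $\lambda$ increases to the upper end of the interval nor as $\lambda$ decreases to its lower end. A \emph{Cauchy surface} is a subset met by every inextendible non-spacelike curve precisely once, i.e. for precisely one value of the parameter, and a Lorentzian manifold is \emph{globally hyperbolic} if it contains a Cauchy surface. (For $k=\infty$ the curves are the smooth ones; $k$ is the same throughout.) A \emph{time orientation} is given by a continuous vector field $V$ with $g[V,V]>0$ everywhere. Let $(\Lambda,g)$ be globally hyperbolic and time-oriented by $V$, let $\omega$ be a $C^n$ one-form on $\Lambda$, let $e,\hbar,c,a>0$, and put $\bar\omega=\frac{e}{\hbar c}\,\omega$. Let $P=\Lambda\times\mathbb R$, with fibre coordinate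 $y$, carry the connection form $\tilde\omega=i(dy+\bar\omega)$ and the Kaluza--Klein metric $g^{\mathrm{kk}}=g+a^2\tilde\omega^2$, that is, $$g^{\mathrm{kk}}(x,y)[(v,u),(v,u)]=g(x)[v,v]-a^2\bigl(u+\bar\omega(x)[v]\bigr)^2,\qquad (v,u)\in T_x\Lambda\times\mathbb R .$$ Then $(P,g^{\mathrm{kk}})$ is a Lorentzian manifold with $C^n$ metric, the horizontal lift $(V,-\bar\omega[V])$ is a time orientation of it, and it is globally hyperbolic. Moreover, if $S$ is any Cauchy surface of $\Lambda$, then $S\times\mathbb R$ is a Cauchy surface of $P$. -/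

import Mathlib

open Set Filter Topology Bundle
open scoped Manifold ContDiff

namespace KaluzaKlein

noncomputable section

section General

variable {E : Type*} [NormedAddCommGroup E] [NormedSpace ℝ E]
  {H : Type*} [TopologicalSpace H] (I : ModelWithCorners ℝ E H)
  {M : Type*} [TopologicalSpace M] [ChartedSpace H M]

/-- A field of bilinear forms on the tangent spaces of `M`. -/
abbrev BilinField : Type _ :=
  (x : M) → TangentSpace I x →L[ℝ] TangentSpace I x →L[ℝ] ℝ

/-- A field of linear forms on the tangent spaces of `M` (a one-form). -/
abbrev OneForm : Type _ :=
  (x : M) → TangentSpace I x →L[ℝ] ℝ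

variable {I}

/-- The one-form `A` is of class `C^n`. -/
def OneForm.IsContMDiff [IsManifold I ∞ M] (n : ℕ∞) (A : OneForm I (M := M)) : Prop :=
  ContMDiff I (I.prod 𝓘(ℝ, E →L[ℝ] ℝ)) n
    (fun x : M => TotalSpace.mk' (E →L[ℝ] ℝ)
      (E := fun y : M => TangentSpace I y →L[ℝ] Trivial M ℝ y) x (A x))

/-- The quadratic form `v ↦ B(v, v)` of a bilinear form on a tangent space. -/
def quadForm {x : M} (B : TangentSpace I x →L[ℝ] TangentSpace I x →L[ℝ] ℝ) :
    QuadraticForm ℝ (TangentSpace I x) :=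
  LinearMap.BilinMap.toQuadraticMap B.toLinearMap₁₂

/-- `g` is a Lorentzian metric of class `C^n`: a symmetric `C^n` field of bilinear forms of
signature `(+,-,…,-)` at every point. -/
structure IsLorentzianMetric [IsManifold I ∞ M] (n : ℕ∞) (g : BilinField I (M := M)) : Prop where
  symm : ∀ (x : M) (v w : TangentSpace I x), g x v w = g x w v
  contMDiff : ContMDiff I (I.prod 𝓘(ℝ, E →L[ℝ] E →L[ℝ] ℝ)) n
    (fun x : M => TotalSpace.mk' (E →L[ℝ] E →L[ℝ] ℝ)
      (E := fun y : M => TangentSpace I y →L[ℝ] TangentSpace I y →L[ℝ] Trivial M ℝ y) x (g x))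
  sigPos_eq : ∀ x : M, sigPos (quadForm (g x)) = 1
  sigNeg_eq : ∀ x : M, sigNeg (quadForm (g x)) + 1 = Module.finrank ℝ (TangentSpace I x)

/-- `(M, g)` is a Lorentzian manifold with `C^n` metric: `M` is a finite-dimensional smooth manifold
without boundary, Hausdorff and second countable, and `g` is a Lorentzian metric on it. -/
structure IsLorentzianManifold [IsManifold I ∞ M] (n : ℕ∞) (g : BilinField I (M := M)) : Prop where
  finiteDimensional : FiniteDimensional ℝ E
  boundaryless : BoundarylessManifold I M
  hausdorff : T2Space M
  secondCountable : SecondCountableTopology M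
  metric : IsLorentzianMetric n g

/-- `V` is a time orientation of `(M, g)`: a continuous everywhere timelike vector field. -/
structure IsTimeOrientation [IsManifold I ∞ M] (g : BilinField I (M := M))
    (V : (x : M) → TangentSpace I x) : Prop where
  continuous : Continuous (fun x : M => (⟨x, V x⟩ : TangentBundle I M))
  timelike : ∀ x : M, 0 < g x (V x) (V x)

variable (I) in
/-- The velocity of a curve `γ` at the parameter `t`. -/
def velocity (γ : ℝ → M) (t : ℝ) : TangentSpace I (γ t) :=
  mfderiv 𝓘(ℝ, ℝ) I γ t (1 : ℝ)

/-- `γ`, restricted to the nonempty open interval `J`, is a non-spacelike curve of class `C^k`: its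
velocity is nowhere spacelike and nowhere zero (the zero vector is not a causal vector). -/
structure IsNonspacelikeCurve (k : ℕ∞) (g : BilinField I (M := M)) (γ : ℝ → M) (J : Set ℝ) :
    Prop where
  isOpen : IsOpen J
  nonempty : J.Nonempty
  ordConnected : J.OrdConnected
  contMDiffOn : ContMDiffOn 𝓘(ℝ, ℝ) I k γ J
  velocity_ne_zero : ∀ t ∈ J, velocity I γ t ≠ 0
  velocity_nonneg : ∀ t ∈ J, 0 ≤ g (γ t) (velocity I γ t) (velocity I γ t)

/-- `p` is an endpoint of `γ : J → M` for increasing parameter. -/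
def IsUpperEndpoint {X : Type*} [TopologicalSpace X] (γ : ℝ → X) (J : Set ℝ) (p : X) : Prop :=
  ∀ U ∈ 𝓝 p, ∃ t ∈ J, ∀ s ∈ J, t ≤ s → γ s ∈ U

/-- `p` is an endpoint of `γ : J → M` for decreasing parameter. -/
def IsLowerEndpoint {X : Type*} [TopologicalSpace X] (γ : ℝ → X) (J : Set ℝ) (p : X) : Prop :=
  ∀ U ∈ 𝓝 p, ∃ t ∈ J, ∀ s ∈ J, s ≤ t → γ s ∈ U

/-- A curve is inextendible if it has no endpoint, neither future nor past. -/
def IsInextendible {X : Type*} [TopologicalSpace X] (γ : ℝ → X) (J : Set ℝ) : Prop :=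
  (∀ p, ¬ IsUpperEndpoint γ J p) ∧ (∀ p, ¬ IsLowerEndpoint γ J p)

/-- `S` is a Cauchy surface of `(M, g)`: every inextendible non-spacelike `C^k` curve intersects it
precisely once (that is, for precisely one value of the parameter). -/
def IsCauchySurface (k : ℕ∞) (g : BilinField I (M := M)) (S : Set M) : Prop :=
  ∀ (γ : ℝ → M) (J : Set ℝ), IsNonspacelikeCurve k g γ J → IsInextendible γ J →
    ∃! t : ℝ, t ∈ J ∧ γ t ∈ S

/-- `(M, g)` is globally hyperbolic: it contains a Cauchy surface. -/
def IsGloballyHyperbolic (k : ℕ∞) (g : BilinField I (M := M)) : Prop :=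
  ∃ S : Set M, IsCauchySurface k g S

end General

section Bundle

variable {E : Type*} [NormedAddCommGroup E] [NormedSpace ℝ E]
  {H : Type*} [TopologicalSpace H] {I : ModelWithCorners ℝ E H}
  {Λ : Type*} [TopologicalSpace Λ] [ChartedSpace H Λ]

/-- The rescaled potential `ω̄ = (e / (ħ c)) A`. -/
def rescaledPotential (e hbar c : ℝ) (A : OneForm I (M := Λ)) : OneForm I (M := Λ) :=
  fun x => (e / (hbar * c)) • A x

/-- The differential of the projection `π : P = Λ × ℝ → Λ`. -/
def dπ (p : Λ × ℝ) : TangentSpace (I.prod 𝓘(ℝ, ℝ)) p →L[ℝ] TangentSpace I p.1 :=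
  mfderiv (I.prod 𝓘(ℝ, ℝ)) I (Prod.fst : Λ × ℝ → Λ) p

/-- The differential `dy` of the fibre coordinate `y : P = Λ × ℝ → ℝ`. -/
def dy (p : Λ × ℝ) : TangentSpace (I.prod 𝓘(ℝ, ℝ)) p →L[ℝ] ℝ :=
  mfderiv (I.prod 𝓘(ℝ, ℝ)) 𝓘(ℝ, ℝ) (Prod.snd : Λ × ℝ → ℝ) p

/-- The one-form `dy + (e / (ħ c)) π^* A` on `P = Λ × ℝ`. -/
def realConnectionForm (e hbar c : ℝ) (A : OneForm I (M := Λ)) :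
    OneForm (I.prod 𝓘(ℝ, ℝ)) (M := Λ × ℝ) :=
  fun p => dy p + (rescaledPotential e hbar c A p.1).comp (dπ p)

/-- The connection one-form `ω̃ = i (dy + (e / (ħ c)) A)` on `P = Λ × ℝ`. -/
def connectionForm (e hbar c : ℝ) (A : OneForm I (M := Λ)) (p : Λ × ℝ) :
    TangentSpace (I.prod 𝓘(ℝ, ℝ)) p →L[ℝ] ℂ :=
  (realConnectionForm e hbar c A p).smulRight Complex.I

/-- The Kaluza–Klein metric `g + a² ω̃² = π^* g - a² (dy + (e / (ħ c)) π^* A)²` on `P = Λ × ℝ`. -/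
def kaluzaKleinMetric (e hbar c a : ℝ) (g : BilinField I (M := Λ)) (A : OneForm I (M := Λ)) :
    BilinField (I.prod 𝓘(ℝ, ℝ)) (M := Λ × ℝ) :=
  fun p =>
    (ContinuousLinearMap.precomp ℝ (dπ p)).comp ((g p.1).comp (dπ p)) -
    a ^ 2 • (realConnectionForm e hbar c A p).smulRight (realConnectionForm e hbar c A p)

/-- The tangent vector `(v, u)` of `P = Λ × ℝ` at `p`, with `v` tangent to `Λ` and `u` to `ℝ`. -/
def pairVec (p : Λ × ℝ) (v : TangentSpace I p.1) (u : ℝ) : TangentSpace (I.prod 𝓘(ℝ, ℝ)) p :=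
  ((v, u) : E × ℝ)

/-- The horizontal lift `(V, -ω̄[V])` to `P` of a vector field `V` on `Λ`. -/
def horizontalLift (e hbar c : ℝ) (A : OneForm I (M := Λ)) (V : (x : Λ) → TangentSpace I x) :
    (p : Λ × ℝ) → TangentSpace (I.prod 𝓘(ℝ, ℝ)) p :=
  fun p => pairVec p (V p.1) (-(rescaledPotential e hbar c A p.1 (V p.1)))

theorem realConnectionForm_apply (e hbar c : ℝ) (A : OneForm I (M := Λ)) (p : Λ × ℝ)
    (v : TangentSpace I p.1) (u : ℝ) :
    realConnectionForm e hbar c A p (pairVec p v u) = u + rescaledPotential e hbar c A p.1 v := by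
  simp only [realConnectionForm, dy, dπ, mfderiv_fst, mfderiv_snd]
  rfl

theorem connectionForm_horizontalLift (e hbar c : ℝ) (A : OneForm I (M := Λ))
    (V : (x : Λ) → TangentSpace I x) (p : Λ × ℝ) :
    connectionForm e hbar c A p (horizontalLift e hbar c A V p) = 0 := by
  simp [connectionForm, horizontalLift, realConnectionForm_apply]

theorem kaluzaKleinMetric_apply (e hbar c a : ℝ) (g : BilinField I (M := Λ))
    (A : OneForm I (M := Λ)) (p : Λ × ℝ) (v v' : TangentSpace I p.1) (u u' : ℝ) :
    kaluzaKleinMetric e hbar c a g A p (pairVec p v u) (pairVec p v' u') =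
      g p.1 v v' - a ^ 2 * ((u + rescaledPotential e hbar c A p.1 v) *
        (u' + rescaledPotential e hbar c A p.1 v')) := by
  rw [← realConnectionForm_apply, ← realConnectionForm_apply]
  simp only [kaluzaKleinMetric, dπ, mfderiv_fst]
  rfl

/-- The Kaluza–Klein metric is `g + a² ω̃²`. -/
theorem kaluzaKleinMetric_eq_connectionForm (e hbar c a : ℝ) (g : BilinField I (M := Λ))
    (A : OneForm I (M := Λ)) (p : Λ × ℝ) (w w' : TangentSpace (I.prod 𝓘(ℝ, ℝ)) p) :
    ((kaluzaKleinMetric e hbar c a g A p w w' : ℝ) : ℂ) =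
      ((g p.1 (dπ p w) (dπ p w') : ℝ) : ℂ) +
      (a : ℂ) ^ 2 * (connectionForm e hbar c A p w * connectionForm e hbar c A p w') := by
  have h : kaluzaKleinMetric e hbar c a g A p w w' =
      g p.1 (dπ p w) (dπ p w') -
      a ^ 2 * (realConnectionForm e hbar c A p w * realConnectionForm e hbar c A p w') := rfl
  rw [h]
  simp only [connectionForm, ContinuousLinearMap.smulRight_apply, Complex.real_smul]
  push_cast
  linear_combination (-(a : ℂ) ^ 2 * (realConnectionForm e hbar c A p w : ℂ) *
    (realConnectionForm e hbar c A p w' : ℂ)) * Complex.I_mul_I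

end Bundle

end

end KaluzaKlein

/-! A vector `(v, u)` has squared length `g(v, v) - a²(u + ω̄(v))²`. Horizontal lifts therefore keep
their length, and if `g` is negative definite on a hyperplane `N`, the new metric is so on `N × ℝ`.
This gives the signature and the time orientation.

For the Cauchy surface, project an inextendible non-spacelike curve of `P` to `Λ`. The projection is
non-spacelike, since only a square was subtracted. The crux is that it is inextendible
(`exists_tendsto_of_tendsto_fst`). Suppose it tends to `p`. In a chart at `p`, causal vectors `w`
satisfy `δ‖w‖ ≤ |l w|` for a fixed linear form `l`, by compactness
(`exists_pos_forall_norm_le_of_negDef_ker`). The causality condition bounds `|u + ω̄(v)|` by `√g(v,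
v) / a`, hence `|u|` by a multiple of `|l w|` (`exists_eventually_abs_vertical_le`). By Cauchy's
mean value theorem the increments of the fibre coordinate are then dominated by those of `l` along
the projected curve, which converges. So the fibre coordinate converges too, and the original curve
would have an endpoint.

Thus the projection meets `S` exactly once, and the curve meets `S × ℝ` at the same parameter. -/

namespace KaluzaKlein

/-! ### Signatures -/

section Signature

variable {W : Type*} [AddCommGroup W] [Module ℝ W] [FiniteDimensional ℝ W]

theorem exists_pos_of_sigPos_eq_one {Q : QuadraticForm ℝ W} (h : sigPos Q = 1) :
    ∃ v, 0 < Q v := by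
  obtain ⟨N, hN, hpos⟩ := exists_finrank_eq_sigPos_and_posDef Q
  have : Nontrivial N := Module.nontrivial_of_finrank_pos (R := ℝ) (by omega)
  obtain ⟨v, hv⟩ := exists_ne (0 : N)
  exact ⟨v, hpos v hv⟩

theorem exists_negDef_of_sigNeg_add_one_eq {Q : QuadraticForm ℝ W}
    (h : sigNeg Q + 1 = Module.finrank ℝ W) :
    ∃ N : Submodule ℝ W, Module.finrank ℝ N + 1 = Module.finrank ℝ W ∧
      ∀ v ∈ N, v ≠ 0 → Q v < 0 := by
  obtain ⟨N, hN, hneg⟩ := exists_finrank_eq_sigNeg_and_negDef Q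
  refine ⟨N, by omega, fun v hv hv0 => ?_⟩
  have := hneg ⟨v, hv⟩ (by simpa using hv0)
  simpa using this

/-- The line through `v` and the hyperplane `N` bound the two indices from below by `1` and `dim W -
1`. The indices and the dimension of the radical add up to `dim W`, so both bounds are attained. -/
theorem signature_eq_of_pos_of_negDef {Q : QuadraticForm ℝ W} {v : W} (hv : 0 < Q v)
    {N : Submodule ℝ W} (hN : Module.finrank ℝ N + 1 = Module.finrank ℝ W)
    (hneg : ∀ v ∈ N, v ≠ 0 → Q v < 0) :
    sigPos Q = 1 ∧ sigNeg Q + 1 = Module.finrank ℝ W := by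
  have hv0 : v ≠ 0 := by rintro rfl; simp at hv
  have h1 : Module.finrank ℝ (ℝ ∙ v) ≤ sigPos Q := by
    refine le_sigPos_of_posDef Q fun x hx => ?_
    obtain ⟨c, hc⟩ := Submodule.mem_span_singleton.1 x.2
    have hc0 : c ≠ 0 := by
      rintro rfl
      exact hx (Subtype.ext (by simpa using hc.symm))
    have : Q x = c * c * Q v := by rw [← hc, QuadraticMap.map_smul, smul_eq_mul]
    change 0 < Q x
    rw [this]
    exact mul_pos (mul_self_pos.2 hc0) hv
  have h2 : Module.finrank ℝ N ≤ sigNeg Q := by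
    refine le_sigNeg_of_negDef Q fun x hx => ?_
    have := hneg x x.2 (by simpa using hx)
    simpa using this
  have h3 := QuadraticForm.sigPos_add_sigNeg_add_radical (Q := Q)
  rw [finrank_span_singleton hv0] at h1
  omega

/-- Applied to a negative definite hyperplane, this gives a linear form that vanishes on no nonzero
causal vector. -/
theorem exists_dual_ker_eq {N : Submodule ℝ W}
    (hN : Module.finrank ℝ N + 1 = Module.finrank ℝ W) :
    ∃ f : W →ₗ[ℝ] ℝ, LinearMap.ker f = N := by
  have h : Module.finrank ℝ (W ⧸ N) = Module.finrank ℝ ℝ := by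
    have := N.finrank_quotient_add_finrank
    rw [Module.finrank_self]
    omega
  refine ⟨(LinearEquiv.ofFinrankEq (W ⧸ N) ℝ h).toLinearMap ∘ₗ N.mkQ, ?_⟩
  rw [LinearEquiv.ker_comp, Submodule.ker_mkQ]

end Signature

/-! ### Stability of causal cones -/

section Cone

variable {E : Type*} [NormedAddCommGroup E] [NormedSpace ℝ E] [FiniteDimensional ℝ E]

/-- On the unit sphere `max |l w| (-B(w, w))` is continuous and positive, so compactness gives a
positive minimum `δ`. If `G` is `δ`-close to `B` and `G(w, w) ≥ 0`, then `-B(w, w) < δ`, so the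
maximum is reached by `|l w|`. Homogeneity does the rest. -/
theorem exists_pos_forall_norm_le_of_negDef_ker (B : E →L[ℝ] E →L[ℝ] ℝ) (l : E →L[ℝ] ℝ)
    (h : ∀ w, l w = 0 → w ≠ 0 → B w w < 0) :
    ∃ δ > 0, ∀ G : E →L[ℝ] E →L[ℝ] ℝ, ‖G - B‖ < δ → ∀ w, 0 ≤ G w w → δ * ‖w‖ ≤ |l w| := by
  have hcont : Continuous fun w : E => max |l w| (-(B w w)) := by fun_prop
  obtain ⟨δ, hδ, hmin⟩ : ∃ δ > 0, ∀ w ∈ Metric.sphere (0 : E) 1, δ ≤ max |l w| (-(B w w)) := by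
    rcases (Metric.sphere (0 : E) 1).eq_empty_or_nonempty with he | hne
    -- The sphere is empty when `E` is trivial; any constant works.
    · exact ⟨1, one_pos, by simp [he]⟩
    obtain ⟨w, hw, hmin⟩ := (isCompact_sphere (0 : E) 1).exists_isMinOn hne hcont.continuousOn
    refine ⟨_, ?_, fun z hz => hmin hz⟩
    have hw0 : w ≠ 0 := ne_zero_of_mem_unit_sphere ⟨w, hw⟩
    by_cases hl : l w = 0
    · exact lt_max_of_lt_right (by linarith [h w hl hw0])
    · exact lt_max_of_lt_left (abs_pos.2 hl)
  refine ⟨δ, hδ, fun G hG w hw => ?_⟩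
  rcases eq_or_ne w 0 with rfl | hw0
  · simp
  have hn : 0 < ‖w‖ := norm_pos_iff.2 hw0
  set z := ‖w‖⁻¹ • w with hz
  have hz1 : ‖z‖ = 1 := by rw [hz, norm_smul, norm_inv, norm_norm, inv_mul_cancel₀ hn.ne']
  have hGz : 0 ≤ G z z := by
    simp only [hz, map_smul, smul_apply, smul_eq_mul]
    positivity
  have hdiff : G z z - B z z < δ := by
    have := (G - B).le_opNorm₂ z z
    rw [hz1, mul_one, mul_one] at this
    exact lt_of_le_of_lt (le_trans (le_abs_self _) this) hG
  have hlz : δ ≤ |l z| := by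
    rcases le_max_iff.1 (hmin z (by simpa using hz1)) with h1 | h1
    · exact h1
    · linarith
  rw [hz, map_smul, smul_eq_mul, abs_mul, abs_inv, abs_norm] at hlz
  rw [mul_comm]
  calc ‖w‖ * δ ≤ ‖w‖ * (‖w‖⁻¹ * |l w|) := by gcongr
    _ = |l w| := by field_simp

end Cone

/-! ### Functions with comparable derivatives -/

/-- Cauchy's mean value theorem gives `(h t - h s) f'(c) = (f t - f s) h'(c)`, and `h'(c) ≠ 0` can
be cancelled. Neither continuity nor integrability of the derivatives is needed. -/
theorem abs_sub_le_of_abs_deriv_le {f h f' h' : ℝ → ℝ} {T : Set ℝ} (hT : T.OrdConnected) {C : ℝ}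
    (hf : ∀ t ∈ T, HasDerivAt f (f' t) t) (hh : ∀ t ∈ T, HasDerivAt h (h' t) t)
    (hne : ∀ t ∈ T, h' t ≠ 0) (hle : ∀ t ∈ T, |f' t| ≤ C * |h' t|) {s t : ℝ} (hs : s ∈ T)
    (ht : t ∈ T) : |f t - f s| ≤ C * |h t - h s| := by
  wlog hst : s < t generalizing s t
  · rcases (not_lt.1 hst).eq_or_lt with rfl | hlt
    · simp
    · rw [abs_sub_comm (f t), abs_sub_comm (h t)]
      exact this ht hs hlt
  have hsub : Icc s t ⊆ T := hT.out hs ht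
  obtain ⟨c, hc, heq⟩ := exists_ratio_hasDerivAt_eq_ratio_slope f f' hst
    (fun x hx => (hf x (hsub hx)).continuousAt.continuousWithinAt)
    (fun x hx => hf x (hsub (Ioo_subset_Icc_self hx))) h h'
    (fun x hx => (hh x (hsub hx)).continuousAt.continuousWithinAt)
    (fun x hx => hh x (hsub (Ioo_subset_Icc_self hx)))
  have hcT := hsub (Ioo_subset_Icc_self hc)
  have hpos : 0 < |h' c| := abs_pos.2 (hne c hcT)
  refine le_of_mul_le_mul_right ?_ hpos
  calc |f t - f s| * |h' c| = |h t - h s| * |f' c| := by rw [← abs_mul, ← abs_mul, heq]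
    _ ≤ |h t - h s| * (C * |h' c|) := by gcongr; exact hle c hcT
    _ = C * |h t - h s| * |h' c| := by ring

/-! ### Endpoints as limits -/

section Endpoint

variable {X : Type*} [TopologicalSpace X] {γ : ℝ → X} {J : Set ℝ} {p : X}

/-- As limits along `atTop` and `atBot`, both ends of a curve are covered by one argument for a
general filter. -/
theorem isUpperEndpoint_iff_tendsto (hJ : J.Nonempty) :
    IsUpperEndpoint γ J p ↔ Tendsto (fun t : J => γ t) atTop (𝓝 p) := by
  have := hJ.to_subtype
  simp only [IsUpperEndpoint, Tendsto, Filter.le_def, mem_map, mem_atTop_sets, mem_preimage,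
    Subtype.forall, Subtype.exists, Subtype.mk_le_mk, exists_prop]

theorem isLowerEndpoint_iff_tendsto (hJ : J.Nonempty) :
    IsLowerEndpoint γ J p ↔ Tendsto (fun t : J => γ t) atBot (𝓝 p) := by
  have := hJ.to_subtype
  simp only [IsLowerEndpoint, Tendsto, Filter.le_def, mem_map, mem_atBot_sets, mem_preimage,
    Subtype.forall, Subtype.exists, Subtype.mk_le_mk, exists_prop]

/-- A real function dominated by a function which converges along a filter converges. -/
theorem exists_tendsto_of_abs_sub_le {α : Type*} {F : Filter α} [F.NeBot] {f h : α → ℝ} {x C : ℝ}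
    {T : Set α} (hT : T ∈ F) (hh : Tendsto h F (𝓝 x))
    (hle : ∀ s ∈ T, ∀ t ∈ T, |f t - f s| ≤ C * |h t - h s|) : ∃ y, Tendsto f F (𝓝 y) := by
  refine cauchy_map_iff_exists_tendsto.1 (cauchy_map_iff.2 ⟨inferInstance, ?_⟩)
  have hc : Tendsto (fun q : α × α => C * |h q.2 - h q.1|) (F ×ˢ F) (𝓝 0) := by
    have := ((hh.comp (tendsto_snd (f := F))).sub (hh.comp (tendsto_fst (g := F)))).abs.const_mul C
    simpa using this
  rw [Metric.uniformity_eq_comap_nhds_zero, tendsto_comap_iff]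
  refine squeeze_zero' (Eventually.of_forall fun _ => dist_nonneg) ?_ hc
  filter_upwards [prod_mem_prod hT hT] with q hq
  rw [Function.comp_apply, dist_comm, Real.dist_eq]
  exact hle _ hq.1 _ hq.2

end Endpoint

end KaluzaKlein

/-! ### Metrics and one-forms in local coordinates -/

namespace KaluzaKlein

section Local

variable {E : Type*} [NormedAddCommGroup E] [NormedSpace ℝ E]
  {H : Type*} [TopologicalSpace H] {I : ModelWithCorners ℝ E H}
  {M : Type*} [TopologicalSpace M] [ChartedSpace H M] [IsManifold I ∞ M]

theorem OneForm.IsContMDiff.const_smul {n : ℕ∞} {A : OneForm I (M := M)} (hA : A.IsContMDiff n)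
    (r : ℝ) : OneForm.IsContMDiff n (fun x => r • A x : OneForm I (M := M)) :=
  ContMDiff.const_smul_section hA

theorem eventually_mem_baseSet (p : M) :
    ∀ᶠ x in 𝓝 p, x ∈ (trivializationAt E (TangentSpace I) p).baseSet :=
  (trivializationAt E (TangentSpace I) p).open_baseSet.mem_nhds
    (FiberBundle.mem_baseSet_trivializationAt' p)

theorem inCoordinates_bilin_apply {g : BilinField I (M := M)} {p x : M}
    (hx : x ∈ (trivializationAt E (TangentSpace I) p).baseSet) (v w : E) :
    ContinuousLinearMap.inCoordinates E (TangentSpace I) (E →L[ℝ] ℝ)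
      (fun y : M => TangentSpace I y →L[ℝ] Trivial M ℝ y) p x p x (g x) v w =
      g x ((trivializationAt E (TangentSpace I) p).symmL ℝ x v)
        ((trivializationAt E (TangentSpace I) p).symmL ℝ x w) := by
  rw [inCoordinates_apply_eq₂ hx hx (mem_univ _)]
  rw [Trivialization.symmL_apply _ hx, Trivialization.symmL_apply _ hx]
  simp

/-- Locally, a continuous one-form is bounded in terms of the coordinates of its argument. -/
theorem OneForm.IsContMDiff.exists_eventually_abs_le {n : ℕ∞} {A : OneForm I (M := M)}
    (hA : A.IsContMDiff n) (p : M) : ∃ K : ℝ, 0 ≤ K ∧ ∀ᶠ x in 𝓝 p, ∀ v : TangentSpace I x,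
      |A x v| ≤ K * ‖(trivializationAt E (TangentSpace I) p).continuousLinearMapAt ℝ x v‖ := by
  have hcont := ((continuousAt_hom_bundle (σ := RingHom.id ℝ) _).1
    (Continuous.continuousAt (x := p) (ContMDiff.continuous hA))).2
  -- The constant is the coordinate norm at `p` plus one; the slack lets continuity carry the bound
  -- to nearby points.
  refine ⟨_, add_nonneg (norm_nonneg (ContinuousLinearMap.inCoordinates E (TangentSpace I) ℝ
    (Trivial M ℝ) p p p p (A p))) zero_le_one, ?_⟩
  filter_upwards [hcont.norm.eventually_le_const (lt_add_one _), eventually_mem_baseSet (I := I) p]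
    with x hx hxb v
  refine le_trans ?_ (mul_le_mul_of_nonneg_right hx (norm_nonneg _))
  refine le_trans (le_of_eq ?_) (ContinuousLinearMap.le_opNorm _ _)
  rw [ContinuousLinearMap.inCoordinates_eq hxb (mem_univ _), Real.norm_eq_abs]
  have hv := (trivializationAt E (TangentSpace I) p).symmL_continuousLinearMapAt (R := ℝ) hxb v
  rw [Trivialization.symmL_apply _ hxb] at hv
  simpa using congrArg (fun z => |A x z|) hv.symm

/-- Locally, the metric is bounded in terms of the coordinates of its arguments. -/
theorem IsLorentzianMetric.exists_eventually_abs_le {n : ℕ∞} {g : BilinField I (M := M)}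
    (hg : IsLorentzianMetric n g) (p : M) : ∃ B : ℝ, 0 ≤ B ∧ ∀ᶠ x in 𝓝 p, ∀ v : TangentSpace I x,
      |g x v v| ≤
        (B * ‖(trivializationAt E (TangentSpace I) p).continuousLinearMapAt ℝ x v‖) ^ 2 := by
  have hcont := ((continuousAt_hom_bundle (σ := RingHom.id ℝ) _).1
    (Continuous.continuousAt (x := p) hg.contMDiff.continuous)).2
  obtain ⟨B, hB⟩ : ∃ B : ℝ, ‖ContinuousLinearMap.inCoordinates E (TangentSpace I) (E →L[ℝ] ℝ)
      (fun y : M => TangentSpace I y →L[ℝ] Trivial M ℝ y) p p p p (g p)‖ < B := exists_gt _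
  have h0 : 0 ≤ B := (norm_nonneg _).trans hB.le
  -- The root puts the bound in the form of a square, ready for comparison with the square of the
  -- connection form.
  refine ⟨√B, Real.sqrt_nonneg _, ?_⟩
  filter_upwards [hcont.norm.eventually_le_const hB, eventually_mem_baseSet (I := I) p]
    with x hx hxb v
  rw [mul_pow, Real.sq_sqrt h0, pow_two, ← mul_assoc]
  refine le_trans ?_ (mul_le_mul_of_nonneg_right (mul_le_mul_of_nonneg_right hx (norm_nonneg _))
    (norm_nonneg _))
  refine le_trans (le_of_eq ?_) (ContinuousLinearMap.le_opNorm₂ _ _ _)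
  rw [Real.norm_eq_abs, inCoordinates_bilin_apply hxb,
    Trivialization.symmL_continuousLinearMapAt _ hxb]

/-- Near a point, causal vectors are dominated in coordinates by a fixed linear form. -/
theorem IsLorentzianMetric.exists_eventually_norm_le {n : ℕ∞} [FiniteDimensional ℝ E]
    {g : BilinField I (M := M)} (hg : IsLorentzianMetric n g) (p : M) :
    ∃ (l : E →L[ℝ] ℝ) (δ : ℝ), 0 < δ ∧ ∀ᶠ x in 𝓝 p, ∀ v : TangentSpace I x, 0 ≤ g x v v →
      δ * ‖(trivializationAt E (TangentSpace I) p).continuousLinearMapAt ℝ x v‖ ≤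
        |l ((trivializationAt E (TangentSpace I) p).continuousLinearMapAt ℝ x v)| := by
  have hfin : FiniteDimensional ℝ (TangentSpace I p) := inferInstanceAs (FiniteDimensional ℝ E)
  have hcont := ((continuousAt_hom_bundle (σ := RingHom.id ℝ) _).1
    (Continuous.continuousAt (x := p) hg.contMDiff.continuous)).2
  let e := trivializationAt E (TangentSpace I) p
  obtain ⟨N, hN, hneg⟩ := exists_negDef_of_sigNeg_add_one_eq (hg.sigNeg_eq p)
  obtain ⟨f, hf⟩ := exists_dual_ker_eq hN
  have hp : p ∈ e.baseSet := FiberBundle.mem_baseSet_trivializationAt' p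
  -- All fibres near `p` are read in the same model space `E`, so one linear form, chosen at `p`,
  -- serves every nearby metric.
  obtain ⟨δ, hδ, hcone⟩ := exists_pos_forall_norm_le_of_negDef_ker
    (ContinuousLinearMap.inCoordinates E (TangentSpace I) (E →L[ℝ] ℝ)
        (fun y : M => TangentSpace I y →L[ℝ] Trivial M ℝ y) p p p p (g p))
    (LinearMap.toContinuousLinearMap (f ∘ₗ (e.symmL ℝ p).toLinearMap)) (by
      intro w hw hw0
      rw [inCoordinates_bilin_apply hp]
      refine hneg _ (by rw [← hf]; exact hw) fun h0 => hw0 ?_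
      rw [← e.continuousLinearMapAt_symmL (R := ℝ) hp w, h0, map_zero])
  refine ⟨LinearMap.toContinuousLinearMap (f ∘ₗ (e.symmL ℝ p).toLinearMap), δ, hδ, ?_⟩
  filter_upwards [Metric.continuousAt_iff'.1 hcont δ hδ, eventually_mem_baseSet (I := I) p]
    with x hx hxb v hv
  refine hcone _ (by simpa [dist_eq_norm] using hx) _ ?_
  rw [inCoordinates_bilin_apply hxb, e.symmL_continuousLinearMapAt hxb]
  exact hv

omit [IsManifold I ∞ M] in
-- In a finite basis `b`, `f x = ∑ bᵢ* ⊗ f x (bᵢ)`: each term is a fixed continuous linear map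
-- applied to a `C^n` function.
theorem contMDiffAt_clm_of_apply {n : ℕ∞} {F : Type*} [NormedAddCommGroup F] [NormedSpace ℝ F]
    {E' : Type*} [NormedAddCommGroup E'] [NormedSpace ℝ E'] [FiniteDimensional ℝ E']
    {f : M → E' →L[ℝ] F} {p : M} (h : ∀ v, ContMDiffAt I 𝓘(ℝ, F) n (fun x => f x v) p) :
    ContMDiffAt I 𝓘(ℝ, E' →L[ℝ] F) n f p := by
  let b := Module.finBasis ℝ E'
  have hf : f = fun x => ∑ i, ContinuousLinearMap.smulRightL ℝ E' F
      (LinearMap.toContinuousLinearMap (b.coord i)) (f x (b i)) := by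
    funext x
    refine ContinuousLinearMap.coe_inj.1 (b.ext fun j => ?_)
    simp [Finsupp.single_apply, b.repr_self]
  rw [hf]
  refine contMDiffAt_finsetSum fun i _ => ?_
  exact (ContinuousLinearMap.contMDiff _).contMDiffAt.comp p (h (b i))

/-- A section of the bundle of bilinear forms is of class `C^n` if it is so when applied to
coordinate vector fields. -/
theorem contMDiffAt_bilin_of_apply {n : ℕ∞} [FiniteDimensional ℝ E]
    {g : BilinField I (M := M)} {p : M}
    (h : ∀ v w : E, ContMDiffAt I 𝓘(ℝ) n (fun x =>
      g x ((trivializationAt E (TangentSpace I) p).symmL ℝ x v)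
        ((trivializationAt E (TangentSpace I) p).symmL ℝ x w)) p) :
    ContMDiffAt I (I.prod 𝓘(ℝ, E →L[ℝ] E →L[ℝ] ℝ)) n
    (fun x : M => TotalSpace.mk' (E →L[ℝ] E →L[ℝ] ℝ)
      (E := fun y : M => TangentSpace I y →L[ℝ] TangentSpace I y →L[ℝ] Trivial M ℝ y) x (g x))
      p := by
  rw [contMDiffAt_hom_bundle]
  refine ⟨contMDiffAt_id, contMDiffAt_clm_of_apply fun v => contMDiffAt_clm_of_apply fun w => ?_⟩
  refine (h v w).congr_of_eventuallyEq ?_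
  filter_upwards [eventually_mem_baseSet (I := I) p] with x hx
  exact inCoordinates_bilin_apply hx v w

end Local
end KaluzaKlein

/-! ### The Kaluza–Klein metric is Lorentzian and time-oriented -/

namespace KaluzaKlein

theorem finrank_submodule_prod_top {W : Type*} [AddCommGroup W] [Module ℝ W]
    [FiniteDimensional ℝ W] (N : Submodule ℝ W) :
    Module.finrank ℝ (N.prod (⊤ : Submodule ℝ ℝ)) = Module.finrank ℝ N + 1 := by
  let f : N.prod (⊤ : Submodule ℝ ℝ) ≃ₗ[ℝ] N × ℝ :=
    { toFun := fun x => (⟨x.1.1, x.2.1⟩, x.1.2)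
      map_add' := fun _ _ => rfl
      map_smul' := fun _ _ => rfl
      invFun := fun y => ⟨(y.1.1, y.2), y.1.2, trivial⟩ }
  rw [f.finrank_eq, Module.finrank_prod, Module.finrank_self]

section Product

variable {E : Type*} [NormedAddCommGroup E] [NormedSpace ℝ E]
  {H : Type*} [TopologicalSpace H] {I : ModelWithCorners ℝ E H}
  {Λ : Type*} [TopologicalSpace Λ] [ChartedSpace H Λ]

theorem kaluzaKleinMetric_apply_eq (e hbar c a : ℝ) (g : BilinField I (M := Λ))
    (A : OneForm I (M := Λ)) (p : Λ × ℝ) (w w' : TangentSpace (I.prod 𝓘(ℝ, ℝ)) p) :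
    kaluzaKleinMetric e hbar c a g A p w w' = g p.1 (dπ p w) (dπ p w') -
      a ^ 2 * ((dy p w + rescaledPotential e hbar c A p.1 (dπ p w)) *
        (dy p w' + rescaledPotential e hbar c A p.1 (dπ p w'))) :=
  rfl

theorem pairVec_dπ_dy (p : Λ × ℝ) (w : TangentSpace (I.prod 𝓘(ℝ, ℝ)) p) :
    pairVec p (dπ p w) (dy p w) = w := by
  simp only [dπ, dy, mfderiv_fst, mfderiv_snd]
  rfl

theorem quadForm_kaluzaKleinMetric_pairVec (e hbar c a : ℝ) (g : BilinField I (M := Λ))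
    (A : OneForm I (M := Λ)) (p : Λ × ℝ) (v : TangentSpace I p.1) (u : ℝ) :
    quadForm (kaluzaKleinMetric e hbar c a g A p) (pairVec p v u) =
      quadForm (g p.1) v - a ^ 2 * (u + rescaledPotential e hbar c A p.1 v) ^ 2 := by
  rw [pow_two (u + _)]
  exact kaluzaKleinMetric_apply e hbar c a g A p v v u u

theorem kaluzaKleinMetric_horizontalLift (e hbar c a : ℝ) (g : BilinField I (M := Λ))
    (A : OneForm I (M := Λ)) (V : (x : Λ) → TangentSpace I x) (p : Λ × ℝ) :
    kaluzaKleinMetric e hbar c a g A p (horizontalLift e hbar c A V p)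
      (horizontalLift e hbar c A V p) = g p.1 (V p.1) (V p.1) := by
  simp [horizontalLift, kaluzaKleinMetric_apply]

variable [IsManifold I ∞ Λ]

/-- Stated for fields along a map `b`, because on `P` the form is evaluated on `dπ` of a coordinate
field, which is a field along `π`. -/
theorem contMDiffAt_apply_one {M' : Type*} {E' H' : Type*} [NormedAddCommGroup E']
    [NormedSpace ℝ E'] [TopologicalSpace H'] {I' : ModelWithCorners ℝ E' H'} [TopologicalSpace M']
    [ChartedSpace H' M'] {n : ℕ∞} {A : OneForm I (M := Λ)} (hA : A.IsContMDiff n)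
    {b : M' → Λ} {v : (m : M') → TangentSpace I (b m)} {p : M'}
    (hv : ContMDiffAt I' I.tangent n (fun m => (⟨b m, v m⟩ : TangentBundle I Λ)) p) :
    ContMDiffAt I' 𝓘(ℝ) n (fun m => A (b m) (v m)) p := by
  have hb : ContMDiffAt I' I n b p := (contMDiffAt_totalSpace.1 hv).1
  have h := ContMDiffAt.clm_bundle_apply (F₂ := ℝ) (E₂ := Trivial Λ ℝ) (b := b)
    (ϕ := fun m => A (b m)) (ContMDiffAt.comp p (ContMDiff.contMDiffAt hA) hb) hv
  simpa using (contMDiffAt_totalSpace.1 h).2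

theorem contMDiffAt_apply_two {M' : Type*} {E' H' : Type*} [NormedAddCommGroup E']
    [NormedSpace ℝ E'] [TopologicalSpace H'] {I' : ModelWithCorners ℝ E' H'} [TopologicalSpace M']
    [ChartedSpace H' M'] {n : ℕ∞} {g : BilinField I (M := Λ)} (hg : IsLorentzianMetric n g)
    {b : M' → Λ} {v w : (m : M') → TangentSpace I (b m)} {p : M'}
    (hv : ContMDiffAt I' I.tangent n (fun m => (⟨b m, v m⟩ : TangentBundle I Λ)) p)
    (hw : ContMDiffAt I' I.tangent n (fun m => (⟨b m, w m⟩ : TangentBundle I Λ)) p) :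
    ContMDiffAt I' 𝓘(ℝ) n (fun m => g (b m) (v m) (w m)) p := by
  have hb : ContMDiffAt I' I n b p := (contMDiffAt_totalSpace.1 hv).1
  have h := ContMDiffAt.clm_bundle_apply₂ (F₃ := ℝ) (E₃ := Trivial Λ ℝ) (b := b)
    (ψ := fun m => g (b m)) (ContMDiffAt.comp p (ContMDiff.contMDiffAt hg.contMDiff) hb) hv hw
  simpa using (contMDiffAt_totalSpace.1 h).2

theorem contMDiffAt_coordinate_section (n : ℕ∞) (p : Λ) (v : E) :
    ContMDiffAt I I.tangent n
      (fun x => (⟨x, (trivializationAt E (TangentSpace I) p).symmL ℝ x v⟩ : TangentBundle I Λ))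
      p := by
  -- The tangent bundle has one derivative less than the manifold.
  have : IsManifold I (n + 1) Λ := .of_le (n := ∞) (by exact_mod_cast le_top)
  have : ContMDiffVectorBundle n E (TangentSpace I : Λ → Type _) I :=
    TangentBundle.contMDiffVectorBundle
  have h := (trivializationAt E (TangentSpace I) p).contMDiffAt_symmL (IB := I) (n := n)
    (FiberBundle.mem_baseSet_trivializationAt' p)
  refine ContMDiffAt.clm_bundle_apply (E₁ := Trivial Λ E) (b := id) (v := fun _ => v) h ?_
  rw [contMDiffAt_totalSpace]
  exact ⟨contMDiffAt_id, by simpa using contMDiffAt_const⟩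

theorem isContMDiff_rescaledPotential {n : ℕ∞} {A : OneForm I (M := Λ)} (hA : A.IsContMDiff n)
    (e hbar c : ℝ) : (rescaledPotential e hbar c A).IsContMDiff n :=
  hA.const_smul _

theorem isLorentzianMetric_kaluzaKleinMetric [FiniteDimensional ℝ E] {n : ℕ∞}
    {g : BilinField I (M := Λ)}
    (hg : IsLorentzianMetric n g) {A : OneForm I (M := Λ)} (hA : A.IsContMDiff n)
    (e hbar c : ℝ) {a : ℝ} (ha : 0 < a) :
    IsLorentzianMetric n (kaluzaKleinMetric e hbar c a g A) := by
  have hfin (p : Λ) : FiniteDimensional ℝ (TangentSpace I p) :=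
    inferInstanceAs (FiniteDimensional ℝ E)
  have hfin' (p : Λ × ℝ) : FiniteDimensional ℝ (TangentSpace (I.prod 𝓘(ℝ, ℝ)) p) :=
    inferInstanceAs (FiniteDimensional ℝ (E × ℝ))
  have hsig (p : Λ × ℝ) : sigPos (quadForm (kaluzaKleinMetric e hbar c a g A p)) = 1 ∧
      sigNeg (quadForm (kaluzaKleinMetric e hbar c a g A p)) + 1 =
        Module.finrank ℝ (TangentSpace (I.prod 𝓘(ℝ, ℝ)) p) := by
    obtain ⟨v, hv⟩ := exists_pos_of_sigPos_eq_one (hg.sigPos_eq p.1)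
    obtain ⟨N, hN, hneg⟩ := exists_negDef_of_sigNeg_add_one_eq (hg.sigNeg_eq p.1)
    -- The positive vector is the horizontal lift of `v`; the negative definite hyperplane is `N ×
    -- ℝ`.
    refine signature_eq_of_pos_of_negDef
      (v := pairVec p v (-rescaledPotential e hbar c A p.1 v))
      (N := (N.prod (⊤ : Submodule ℝ ℝ) : Submodule ℝ (E × ℝ))) ?_ ?_ ?_
    · simpa [quadForm_kaluzaKleinMetric_pairVec] using hv
    · have h1 : Module.finrank ℝ (TangentSpace (I.prod 𝓘(ℝ, ℝ)) p) =
          Module.finrank ℝ (TangentSpace I p.1) + 1 := by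
        change Module.finrank ℝ (E × ℝ) = Module.finrank ℝ E + 1
        simp
      rw [h1, ← hN]
      exact congrArg (· + 1) (finrank_submodule_prod_top N)
    · suffices h : ∀ (w : TangentSpace I p.1) (u : ℝ), w ∈ N → pairVec p w u ≠ 0 →
          quadForm (kaluzaKleinMetric e hbar c a g A p) (pairVec p w u) < 0 from
        fun z hz hz0 => h z.1 z.2 hz.1 hz0
      intro w u hw hw0
      rw [quadForm_kaluzaKleinMetric_pairVec]
      rcases eq_or_ne w 0 with h0 | h0
      · have hu : u ≠ 0 := by
          rintro rfl
          exact hw0 (Prod.ext h0 rfl)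
        rw [h0]
        simp only [map_zero, add_zero, zero_sub, neg_lt_zero]
        positivity
      · have := hneg w hw h0
        have : 0 ≤ a ^ 2 * (u + rescaledPotential e hbar c A p.1 w) ^ 2 := by positivity
        linarith
  refine ⟨fun p w w' => ?_, fun p => contMDiffAt_bilin_of_apply fun v w => ?_,
    fun p => (hsig p).1, fun p => (hsig p).2⟩
  · rw [kaluzaKleinMetric_apply_eq, kaluzaKleinMetric_apply_eq, hg.symm]
    ring
  -- The projections are taken of class `C^(n+1)` so that their tangent maps are `C^n`. On
  -- coordinate fields the metric is then a polynomial in `C^n` functions.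
  · have hfst : ContMDiff (I.prod 𝓘(ℝ, ℝ)) I (n + 1) (Prod.fst : Λ × ℝ → Λ) := contMDiff_fst
    have hsnd : ContMDiff (I.prod 𝓘(ℝ, ℝ)) 𝓘(ℝ, ℝ) (n + 1) (Prod.snd : Λ × ℝ → ℝ) := contMDiff_snd
    have hπ (v : E × ℝ) := ((hfst.contMDiff_tangentMap (m := n) le_rfl).contMDiffAt).comp p
      (contMDiffAt_coordinate_section (I := I.prod 𝓘(ℝ, ℝ)) n p v)
    have hy (v : E × ℝ) := (contMDiff_snd_tangentBundle_modelSpace (n := n) ℝ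
      𝓘(ℝ, ℝ)).contMDiffAt.comp p (((hsnd.contMDiff_tangentMap (m := n) le_rfl).contMDiffAt).comp p
      (contMDiffAt_coordinate_section (I := I.prod 𝓘(ℝ, ℝ)) n p v))
    have hω (v : E × ℝ) := contMDiffAt_apply_one (isContMDiff_rescaledPotential hA e hbar c) (hπ v)
    exact (contMDiffAt_apply_two hg (hπ v) (hπ w)).sub
      (contMDiffAt_const.mul (((hy v).add (hω v)).mul ((hy w).add (hω w))))

theorem isLorentzianManifold_kaluzaKleinMetric {n : ℕ∞} {g : BilinField I (M := Λ)}
    (hg : IsLorentzianManifold n g) {A : OneForm I (M := Λ)} (hA : A.IsContMDiff n)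
    (e hbar c : ℝ) {a : ℝ} (ha : 0 < a) :
    IsLorentzianManifold n (kaluzaKleinMetric e hbar c a g A) := by
  have := hg.finiteDimensional
  have := hg.boundaryless
  have := hg.hausdorff
  have := hg.secondCountable
  exact ⟨inferInstance, inferInstance, inferInstance, inferInstance,
    isLorentzianMetric_kaluzaKleinMetric hg.metric hA e hbar c ha⟩

theorem isTimeOrientation_horizontalLift {n : ℕ∞} {g : BilinField I (M := Λ)}
    {A : OneForm I (M := Λ)} (hA : A.IsContMDiff n) {V : (x : Λ) → TangentSpace I x}
    (hV : IsTimeOrientation g V) (e hbar c a : ℝ) :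
    IsTimeOrientation (kaluzaKleinMetric e hbar c a g A) (horizontalLift e hbar c A V) where
  continuous := by
    have h1 : Continuous fun p : Λ × ℝ => (⟨p.1, V p.1⟩ : TangentBundle I Λ) :=
      hV.continuous.comp continuous_fst
    have h2 : Continuous fun x : Λ => rescaledPotential e hbar c A x (V x) := by
      -- `V` is only continuous, so the evaluation lemma is used in class `C^0`.
      have hA0 : A.IsContMDiff 0 := ContMDiff.of_le hA (by simp)
      have hV0 : ContMDiff I I.tangent ((0 : ℕ∞) : ℕ∞ω)
          (fun x => (⟨x, V x⟩ : TangentBundle I Λ)) := by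
        simpa [contMDiff_zero_iff] using hV.continuous
      exact continuous_iff_continuousAt.2 fun x => (contMDiffAt_apply_one
        (isContMDiff_rescaledPotential hA0 e hbar c) hV0.contMDiffAt).continuousAt
    have h3 : Continuous fun p : Λ × ℝ =>
        (⟨p.2, -rescaledPotential e hbar c A p.1 (V p.1)⟩ : TangentBundle 𝓘(ℝ, ℝ) ℝ) :=
      (tangentBundleModelSpaceHomeomorph 𝓘(ℝ, ℝ)).symm.continuous.comp
        (continuous_snd.prodMk (h2.comp continuous_fst).neg)
    exact (contMDiff_equivTangentBundleProd_symm (n := 0) (I := I) (I' := 𝓘(ℝ, ℝ)) (M := Λ)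
      (M' := ℝ)).continuous.comp (h1.prodMk h3)
  timelike p := by
    rw [kaluzaKleinMetric_horizontalLift]
    exact hV.timelike p.1

end Product

end KaluzaKlein

/-! ### Projecting non-spacelike curves to the base -/

namespace KaluzaKlein

section Curves

variable {E : Type*} [NormedAddCommGroup E] [NormedSpace ℝ E]
  {H : Type*} [TopologicalSpace H] {I : ModelWithCorners ℝ E H}
  {Λ : Type*} [TopologicalSpace Λ] [ChartedSpace H Λ]

section Projection

variable {γ : ℝ → Λ × ℝ} {t : ℝ}

theorem velocity_fst (hγ : MDifferentiableAt 𝓘(ℝ, ℝ) (I.prod 𝓘(ℝ, ℝ)) γ t) :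
    velocity I (fun s => (γ s).1) t = dπ (γ t) (velocity (I.prod 𝓘(ℝ, ℝ)) γ t) := by
  have h := mfderiv_comp t (mdifferentiableAt_fst (I := I) (I' := 𝓘(ℝ, ℝ))) hγ
  exact congrArg (fun L => L (1 : ℝ)) h

theorem hasDerivAt_snd (hγ : MDifferentiableAt 𝓘(ℝ, ℝ) (I.prod 𝓘(ℝ, ℝ)) γ t) :
    HasDerivAt (fun s => (γ s).2) (dy (γ t) (velocity (I.prod 𝓘(ℝ, ℝ)) γ t)) t := by
  have h := HasMFDerivAt.comp t
    (mdifferentiableAt_snd (I := I) (I' := 𝓘(ℝ, ℝ)) (x := γ t)).hasMFDerivAt hγ.hasMFDerivAt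
  have h' : HasFDerivAt (fun s => (γ s).2) (_ : ℝ →L[ℝ] ℝ) t := hasMFDerivAt_iff_hasFDerivAt.1 h
  exact h'.hasDerivAt

end Projection

theorem IsNonspacelikeCurve.mdifferentiableAt {k : ℕ∞} (hk : 1 ≤ k) {g : BilinField I (M := Λ)}
    {γ : ℝ → Λ} {J : Set ℝ} (hγ : IsNonspacelikeCurve k g γ J) {t : ℝ} (ht : t ∈ J) :
    MDifferentiableAt 𝓘(ℝ, ℝ) I γ t :=
  (hγ.contMDiffOn.contMDiffAt (hγ.isOpen.mem_nhds ht)).mdifferentiableAt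
    (by rintro h; simp at h; simp [h] at hk)

/-- The Kaluza–Klein square is at most `g(v, v)`. If `v = 0` it equals `-a²u²`, so non-negativity
forces `u = 0` and the whole velocity would vanish. -/
theorem IsNonspacelikeCurve.fst {k : ℕ∞} (hk : 1 ≤ k) {g : BilinField I (M := Λ)}
    {A : OneForm I (M := Λ)} {e hbar c a : ℝ} (ha : 0 < a) {γ : ℝ → Λ × ℝ} {J : Set ℝ}
    (hγ : IsNonspacelikeCurve k (kaluzaKleinMetric e hbar c a g A) γ J) :
    IsNonspacelikeCurve k g (fun t => (γ t).1) J where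
  isOpen := hγ.isOpen
  nonempty := hγ.nonempty
  ordConnected := hγ.ordConnected
  contMDiffOn := contMDiff_fst.comp_contMDiffOn hγ.contMDiffOn
  velocity_ne_zero t ht h0 := by
    rw [velocity_fst (hγ.mdifferentiableAt hk ht)] at h0
    have h1 := hγ.velocity_nonneg t ht
    rw [kaluzaKleinMetric_apply_eq, h0] at h1
    simp only [map_zero, add_zero, zero_sub] at h1
    apply hγ.velocity_ne_zero t ht
    rw [← pairVec_dπ_dy (γ t) (velocity _ γ t), h0]
    have h2 : dy (γ t) (velocity (I.prod 𝓘(ℝ, ℝ)) γ t) = 0 := by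
      by_contra hne
      have := mul_pos (pow_pos ha 2) (mul_self_pos.2 hne)
      linarith
    rw [h2]
    rfl
  velocity_nonneg t ht := by
    rw [velocity_fst (hγ.mdifferentiableAt hk ht)]
    have h1 := hγ.velocity_nonneg t ht
    rw [kaluzaKleinMetric_apply_eq] at h1
    have := mul_nonneg (sq_nonneg a) (mul_self_nonneg (dy (γ t) (velocity (I.prod 𝓘(ℝ, ℝ)) γ t) +
      rescaledPotential e hbar c A (γ t).1 (dπ (γ t) (velocity (I.prod 𝓘(ℝ, ℝ)) γ t))))
    linarith

variable [IsManifold I ∞ Λ]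

/-- The trivialization of the tangent bundle at `p` is the differential of the chart at `p`. This
links the pointwise cone estimates to derivatives of real functions. -/
theorem hasDerivAt_extChartAt_comp {γ : ℝ → Λ} {t : ℝ} (hγ : MDifferentiableAt 𝓘(ℝ, ℝ) I γ t)
    {p : Λ} (hp : γ t ∈ (trivializationAt E (TangentSpace I) p).baseSet) :
    HasDerivAt (fun s => extChartAt I p (γ s))
      ((trivializationAt E (TangentSpace I) p).continuousLinearMapAt ℝ (γ t) (velocity I γ t))
      t := by
  rw [TangentBundle.trivializationAt_baseSet] at hp
  rw [TangentBundle.continuousLinearMapAt_trivializationAt hp]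
  have h := HasMFDerivAt.comp t (mdifferentiableAt_extChartAt (I := I) hp).hasMFDerivAt
    hγ.hasMFDerivAt
  have h' : HasFDerivAt (fun s => extChartAt I p (γ s)) (_ : ℝ →L[ℝ] E) t :=
    hasMFDerivAt_iff_hasFDerivAt.1 h
  exact h'.hasDerivAt

/-- Near a point of the base, tangent vectors of `P` that are non-spacelike for the Kaluza–Klein
metric have a vertical component dominated by a fixed linear form in the horizontal one. -/
theorem exists_eventually_abs_vertical_le [FiniteDimensional ℝ E] {n : ℕ∞}
    {g : BilinField I (M := Λ)} (hg : IsLorentzianMetric n g) {A : OneForm I (M := Λ)}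
    (hA : A.IsContMDiff n) {a : ℝ} (ha : 0 < a) (p : Λ) :
    ∃ (l : E →L[ℝ] ℝ) (C : ℝ), ∀ᶠ x in 𝓝 p, ∀ (v : TangentSpace I x) (u : ℝ),
      0 ≤ g x v v - a ^ 2 * ((u + A x v) * (u + A x v)) → v ≠ 0 →
      l ((trivializationAt E (TangentSpace I) p).continuousLinearMapAt ℝ x v) ≠ 0 ∧
      |u| ≤ C * |l ((trivializationAt E (TangentSpace I) p).continuousLinearMapAt ℝ x v)| := by
  obtain ⟨l, δ, hδ, hl⟩ := hg.exists_eventually_norm_le p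
  obtain ⟨K, hK, hAK⟩ := hA.exists_eventually_abs_le p
  obtain ⟨B, hB, hgB⟩ := hg.exists_eventually_abs_le p
  -- `|A(v)| ≤ K‖w‖`, `|u + A(v)| ≤ (B / a)‖w‖` by causality, and `‖w‖ ≤ δ⁻¹|l w|`.
  refine ⟨l, (K + B / a) * δ⁻¹, ?_⟩
  filter_upwards [hl, hAK, hgB, eventually_mem_baseSet (I := I) p] with x hx hxA hxg hxb v u h hv
  have hsq : 0 ≤ a ^ 2 * ((u + A x v) * (u + A x v)) :=
    mul_nonneg (sq_nonneg a) (mul_self_nonneg _)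
  have hlv := hx v (by linarith)
  have hAv := hxA v
  have hgv := hxg v
  set w := (trivializationAt E (TangentSpace I) p).continuousLinearMapAt ℝ x v with hw
  have hw0 : w ≠ 0 := fun h0 => hv (by
    rw [← (trivializationAt E (TangentSpace I) p).symmL_continuousLinearMapAt (R := ℝ) hxb v, ← hw,
      h0, map_zero])
  have hwpos : 0 < ‖w‖ := norm_pos_iff.2 hw0
  refine ⟨abs_pos.1 (lt_of_lt_of_le (mul_pos hδ hwpos) hlv), ?_⟩
  have h1 : |u + A x v| ≤ B / a * ‖w‖ := by
    refine abs_le_of_sq_le_sq ?_ (by positivity)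
    rw [mul_pow, div_pow, div_mul_eq_mul_div, le_div_iff₀ (by positivity)]
    nlinarith [le_abs_self (g x v v)]
  have h2 : |u| ≤ (K + B / a) * ‖w‖ := by
    have := abs_sub (u + A x v) (A x v)
    rw [add_sub_cancel_right] at this
    linarith
  calc |u| ≤ (K + B / a) * ‖w‖ := h2
    _ = (K + B / a) * δ⁻¹ * (δ * ‖w‖) := by field_simp
    _ ≤ _ := by gcongr

/-- If the projection to the base of a curve that is non-spacelike for the Kaluza–Klein metric
converges along a filter containing arbitrarily small intervals, then so does the curve. -/
theorem exists_tendsto_of_tendsto_fst [FiniteDimensional ℝ E] {n k : ℕ∞} (hk : 1 ≤ k)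
    {g : BilinField I (M := Λ)} (hg : IsLorentzianMetric n g) {A : OneForm I (M := Λ)}
    (hA : A.IsContMDiff n) {e hbar c a : ℝ} (ha : 0 < a) {γ : ℝ → Λ × ℝ} {J : Set ℝ}
    (hγ : IsNonspacelikeCurve k (kaluzaKleinMetric e hbar c a g A) γ J) {F : Filter J} [F.NeBot]
    (hF : ∀ s ∈ F, ∃ T ⊆ s, T ∈ F ∧ ((↑) '' T : Set ℝ).OrdConnected) {p : Λ}
    (hp : Tendsto (fun t : J => (γ t).1) F (𝓝 p)) : ∃ q, Tendsto (fun t : J => γ t) F (𝓝 q) := by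
  obtain ⟨l, C, hlC⟩ := exists_eventually_abs_vertical_le hg
    (isContMDiff_rescaledPotential hA e hbar c) ha p
  -- The local estimates must hold on a whole interval for the mean value theorem to apply.
  obtain ⟨T, hT, hTF, hTc⟩ := hF _ (hp.eventually (hlC.and (eventually_mem_baseSet (I := I) p)))
  have hγ' := hγ.fst hk ha
  have hlim : Tendsto (fun t : J => l (extChartAt I p (γ t).1)) F (𝓝 (l (extChartAt I p p))) :=
    (l.continuous.tendsto _).comp ((continuousAt_extChartAt p).tendsto.comp hp)
  let w (t : ℝ) : E := (trivializationAt E (TangentSpace I) p).continuousLinearMapAt ℝ (γ t).1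
    (velocity I (fun s => (γ s).1) t)
  have hkey : ∀ t ∈ ((↑) '' T : Set ℝ), l (w t) ≠ 0 ∧
      |dy (γ t) (velocity (I.prod 𝓘(ℝ, ℝ)) γ t)| ≤ C * |l (w t)| := by
    rintro _ ⟨t, ht, rfl⟩
    have h := (hT ht).1 (dπ (γ t) (velocity (I.prod 𝓘(ℝ, ℝ)) γ t)) (dy (γ t) (velocity (I.prod 𝓘(ℝ, ℝ)) γ t))
      (hγ.velocity_nonneg t t.2)
    rw [← velocity_fst (hγ.mdifferentiableAt hk t.2)] at h
    exact h (hγ'.velocity_ne_zero t t.2)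
  -- The fibre coordinate is compared with `l` of the chart coordinates, whose limit is known.
  obtain ⟨y, hy⟩ := exists_tendsto_of_abs_sub_le hTF hlim fun s hs t ht =>
    abs_sub_le_of_abs_deriv_le (f := fun t => (γ t).2) (h := fun t => l (extChartAt I p (γ t).1))
      (C := C) hTc
      (fun t ht => by
        obtain ⟨t, ht, rfl⟩ := ht
        exact hasDerivAt_snd (hγ.mdifferentiableAt hk t.2))
      (fun t ht => by
        obtain ⟨t, ht, rfl⟩ := ht
        exact l.hasFDerivAt.comp_hasDerivAt (t : ℝ)
          (hasDerivAt_extChartAt_comp (hγ'.mdifferentiableAt hk t.2) (hT ht).2))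
      (fun t ht => (hkey t ht).1) (fun t ht => (hkey t ht).2)
      (mem_image_of_mem _ hs) (mem_image_of_mem _ ht)
  exact ⟨(p, y), hp.prodMk_nhds hy⟩

theorem IsNonspacelikeCurve.isInextendible_fst [FiniteDimensional ℝ E] {n k : ℕ∞} (hk : 1 ≤ k)
    {g : BilinField I (M := Λ)} (hg : IsLorentzianMetric n g) {A : OneForm I (M := Λ)}
    (hA : A.IsContMDiff n) {e hbar c a : ℝ} (ha : 0 < a) {γ : ℝ → Λ × ℝ} {J : Set ℝ}
    (hγ : IsNonspacelikeCurve k (kaluzaKleinMetric e hbar c a g A) γ J)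
    (hinext : IsInextendible γ J) : IsInextendible (fun t => (γ t).1) J := by
  have := hγ.nonempty.to_subtype
  refine ⟨fun p hp => ?_, fun p hp => ?_⟩
  · rw [isUpperEndpoint_iff_tendsto hγ.nonempty] at hp
    obtain ⟨q, hq⟩ := exists_tendsto_of_tendsto_fst hk hg hA ha hγ (F := atTop) (fun s hs => by
      obtain ⟨t, ht⟩ := mem_atTop_sets.1 hs
      refine ⟨Ici t, ht, Ici_mem_atTop t, ⟨?_⟩⟩
      rintro _ ⟨x, hx, rfl⟩ _ ⟨y, hy, rfl⟩ z hz
      exact ⟨⟨z, hγ.ordConnected.out x.2 y.2 hz⟩, le_trans hx hz.1, rfl⟩) hp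
    exact hinext.1 q ((isUpperEndpoint_iff_tendsto hγ.nonempty).2 hq)
  · rw [isLowerEndpoint_iff_tendsto hγ.nonempty] at hp
    obtain ⟨q, hq⟩ := exists_tendsto_of_tendsto_fst hk hg hA ha hγ (F := atBot) (fun s hs => by
      obtain ⟨t, ht⟩ := mem_atBot_sets.1 hs
      refine ⟨Iic t, ht, Iic_mem_atBot t, ⟨?_⟩⟩
      rintro _ ⟨x, hx, rfl⟩ _ ⟨y, hy, rfl⟩ z hz
      exact ⟨⟨z, hγ.ordConnected.out x.2 y.2 hz⟩, le_trans hz.2 hy, rfl⟩) hp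
    exact hinext.2 q ((isLowerEndpoint_iff_tendsto hγ.nonempty).2 hq)

/-- A curve lies in `S × ℝ` at exactly the parameters at which its projection lies in `S`, and `hS`
applies to the projection. -/
theorem IsCauchySurface.prod_univ [FiniteDimensional ℝ E] {n k : ℕ∞} (hk : 1 ≤ k)
    {g : BilinField I (M := Λ)} (hg : IsLorentzianMetric n g) {A : OneForm I (M := Λ)}
    (hA : A.IsContMDiff n) (e hbar c : ℝ) {a : ℝ} (ha : 0 < a) {S : Set Λ}
    (hS : IsCauchySurface k g S) :
    IsCauchySurface k (kaluzaKleinMetric e hbar c a g A) (S ×ˢ (univ : Set ℝ)) := by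
  intro γ J hγ hinext
  simpa using hS _ J (hγ.fst hk ha) (hγ.isInextendible_fst hk hg hA ha hinext)

end Curves

end KaluzaKlein

theorem mainTheorem5
    {E : Type*} [NormedAddCommGroup E] [NormedSpace ℝ E]
    {H : Type*} [TopologicalSpace H] {I : ModelWithCorners ℝ E H}
    {Λ : Type*} [TopologicalSpace Λ] [ChartedSpace H Λ] [IsManifold I ∞ Λ]
    (n k : ℕ∞) (hk : 1 ≤ k)
    (g : KaluzaKlein.BilinField I (M := Λ)) (hΛ : KaluzaKlein.IsLorentzianManifold n g)
    (V : (x : Λ) → TangentSpace I x) (hV : KaluzaKlein.IsTimeOrientation g V)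
    (hgh : KaluzaKlein.IsGloballyHyperbolic k g)
    (A : KaluzaKlein.OneForm I (M := Λ)) (hA : A.IsContMDiff n)
    (e hbar c a : ℝ) (he : 0 < e) (hhbar : 0 < hbar) (hc : 0 < c) (ha : 0 < a) :
    KaluzaKlein.IsLorentzianManifold n
        (KaluzaKlein.kaluzaKleinMetric e hbar c a g A) ∧
      KaluzaKlein.IsTimeOrientation (KaluzaKlein.kaluzaKleinMetric e hbar c a g A)
        (KaluzaKlein.horizontalLift e hbar c A V) ∧
      KaluzaKlein.IsGloballyHyperbolic k (KaluzaKlein.kaluzaKleinMetric e hbar c a g A) ∧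
      ∀ S : Set Λ, KaluzaKlein.IsCauchySurface k g S →
        KaluzaKlein.IsCauchySurface k (KaluzaKlein.kaluzaKleinMetric e hbar c a g A)
          (S ×ˢ (Set.univ : Set ℝ)) := by
  have := hΛ.finiteDimensional
  refine ⟨KaluzaKlein.isLorentzianManifold_kaluzaKleinMetric hΛ hA e hbar c ha,
    KaluzaKlein.isTimeOrientation_horizontalLift hA hV e hbar c a, ?_,
    fun S hS => hS.prod_univ hk hΛ.metric hA e hbar c ha⟩
  obtain ⟨S, hS⟩ := hgh
  exact ⟨_, hS.prod_univ hk hΛ.metric hA e hbar c ha⟩
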